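/- For a nonempty set $E\subset\mathbb{R}^N$ and a bounded set $Q\subset\mathbb{R}^N$ of positive diameter, let $$\beta_E(Q):=\inf_{\ell}\ \sup_{x\in E\cap Q}\frac{\operatorname{dist}(x,\ell)}{\operatorname{diam} Q},$$ where $\ell$ ranges over all straight lines in $\mathbb{R}^N$ (and $\beta_E(Q)=0$ if $E\cap Q=\emptyset$). Write $B(x,r)$ and $\overline{B}(x,r)$ for the open and closed balls and $\mathcal{H}^s$ for the $s$-dimensional Hausdorff measure. The set $E$ is called lower Ahlfors $s$-regular with constant $c>0$ if $\mathcal{H}^s(E\cap B(x,r))\ge c\,r^s$ for all $x\in E$ and $0<r\le\operatorname{diam}E$. **Proposition 1.3.** There exists an absolute constant $\beta_1\in(0,1)$ such that for every $s>1$ there is a constant $C_s\in(0,\infty)$, depending only on $s$, with the following property. Let $N\in\mathbb{N}$, let $c>0$, and let $E\subset\mathbb{R}^N$ be a compact connected set with at least two points such that $\mathcal{H}^s(E)<\infty$, $E$ is lower Ahlfors $s$-regular with constant $c$, and $$\beta_E\big(\overline{B}(x,r)\big)\le\beta_1\qquad\text{for all }x\in E\text{ and }0<r\le\operatorname{diam}E.$$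 Then $E=f([0,1])$ for some injective map $f:[0,1]\to\mathbb{R}^N$ satisfying $|f(x)-f(y)|\le H|x-y|^{1/s}$ for all $x,y\in[0,1]$, with $$H\le C_s\,c^{-1}\,\mathcal{H}^s(E)\,(\operatorname{diam}E)^{1-s}.$$ -/

import Mathlib

open MeasureTheory Metric
open scoped ENNReal NNReal

/-- A straight line: an affine subspace whose direction is one-dimensional. -/
def IsStraightLine {N : ℕ} (ℓ : AffineSubspace ℝ (EuclideanSpace ℝ (Fin N))) : Prop :=
  Module.finrank ℝ ℓ.direction = 1

/-- The Jones beta number `inf_ℓ sup_{x ∈ E ∩ Q} dist(x, ℓ) / diam Q`, with `ℓ` ranging over all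
straight lines, as an extended non-negative real. The supremum over the empty set is `0`, so the
value is `0` when `E ∩ Q = ∅` (in dimension at least one). -/
noncomputable def jonesBeta {N : ℕ} (E Q : Set (EuclideanSpace ℝ (Fin N))) : ℝ≥0∞ :=
  ⨅ (ℓ : AffineSubspace ℝ (EuclideanSpace ℝ (Fin N))) (_ : IsStraightLine ℓ),
    ⨆ x ∈ E ∩ Q, infEDist x (ℓ : Set (EuclideanSpace ℝ (Fin N))) / ediam Q

/-- `E` is lower Ahlfors `s`-regular with constant `c`. -/
def IsLowerAhlforsRegular {N : ℕ} (s c : ℝ) (E : Set (EuclideanSpace ℝ (Fin N))) : Prop :=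
  0 < c ∧ ∀ x ∈ E, ∀ r : ℝ, 0 < r → r ≤ diam E →
    ENNReal.ofReal (c * r ^ s) ≤ Measure.hausdorffMeasure s (E ∩ ball x r)

/-! Flatness at every scale makes `E` linearly ordered. At each point and dyadic scale choose a
direction of approximation; directions at neighbouring points or consecutive scales agree up to
sign, and the signs can be chosen coherently (`exists_oriented_directions`). Let `R x y` be the sign
of the inner product of `y - x` with the oriented direction at `x`, at a scale comparable to the
distance. This is a tournament, locally constant off the diagonal, and connectedness forces it to be
transitive.

The parametrization is inverse to `g x`, the `s`-measure of the set of predecessors of `x`. An order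
interval contains a ball of radius comparable to the distance of its endpoints, so lower regularity
bounds `|g x - g y|` below by a multiple of `dist x y ^ s`. Finite measure and null points make `g`
continuous. Hence `g` is a bijection onto an interval with `1/s`-Hölder inverse. -/

/-! ### From beta numbers to flat directions. -/

/-- Each point of `E` in the ball `closedBall x r` lies within `η * r` of the line through `x` with
direction `v`. -/
def IsFlatDirection {V : Type*} [NormedAddCommGroup V] [NormedSpace ℝ V] (E : Set V) (η : ℝ)
    (x : V) (r : ℝ) (v : V) : Prop :=
  ‖v‖ = 1 ∧ ∀ y ∈ E, dist y x ≤ r → ∃ t : ℝ, ‖y - x - t • v‖ ≤ η * r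

/-- The infimum need not be attained, so a line with bound `2 * β` is used; as the diameter is at
most `2 * r`, it passes within `5 * β * r`. Translating it to pass through `x` costs the same again.
-/
theorem exists_isFlatDirection_of_jonesBeta_le {N : ℕ} {E : Set (EuclideanSpace ℝ (Fin N))}
    {β : ℝ} (hβ : 0 < β) {x : EuclideanSpace ℝ (Fin N)} (hx : x ∈ E) {r : ℝ} (hr : 0 < r)
    (h : jonesBeta E (closedBall x r) ≤ ENNReal.ofReal β) :
    ∃ v, IsFlatDirection E (10 * β) x r v := by
  have h2 : jonesBeta E (closedBall x r) < ENNReal.ofReal (2 * β) :=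
    h.trans_lt ((ENNReal.ofReal_lt_ofReal_iff (by positivity)).2 (by linarith))
  unfold jonesBeta at h2
  simp only [iInf_lt_iff] at h2
  obtain ⟨ℓ, hℓ, h2⟩ := h2
  have hnear : ∀ y ∈ E, dist y x ≤ r → ∃ p ∈ ℓ, dist y p < 5 * β * r := by
    intro y hy hyr
    have h3 : infEDist y (ℓ : Set (EuclideanSpace ℝ (Fin N))) / ediam (closedBall x r) ≤
        ENNReal.ofReal (2 * β) := by
      refine le_trans ?_ h2.le
      exact le_iSup₂ (f := fun x' (_ : x' ∈ E ∩ closedBall x r) =>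
        infEDist x' (ℓ : Set (EuclideanSpace ℝ (Fin N))) / ediam (closedBall x r)) y ⟨hy, hyr⟩
    have hd : ediam (closedBall x r) ≤ ENNReal.ofReal (2 * r) := by
      refine Metric.ediam_le ?_
      intro a ha b hb
      rw [edist_dist]
      refine ENNReal.ofReal_le_ofReal ?_
      have := dist_triangle_right a b x
      rw [mem_closedBall] at ha hb
      linarith
    have h4 : infEDist y (ℓ : Set (EuclideanSpace ℝ (Fin N))) ≤
        ENNReal.ofReal (2 * β) * ediam (closedBall x r) :=
      (ENNReal.div_le_iff_le_mul (Or.inr ENNReal.ofReal_ne_top)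
        (Or.inl (hd.trans_lt ENNReal.ofReal_lt_top).ne)).1 h3
    have h5 : infEDist y (ℓ : Set (EuclideanSpace ℝ (Fin N))) < ENNReal.ofReal (5 * β * r) := by
      refine (h4.trans (mul_le_mul_right hd _)).trans_lt ?_
      rw [← ENNReal.ofReal_mul (by positivity)]
      refine (ENNReal.ofReal_lt_ofReal_iff (by positivity)).2 ?_
      nlinarith [mul_pos hβ hr]
    obtain ⟨p, hp, hlt⟩ := infEDist_lt_iff.1 h5
    refine ⟨p, hp, ?_⟩
    rw [edist_dist] at hlt
    exact (ENNReal.ofReal_lt_ofReal_iff (by positivity)).1 hlt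
  obtain ⟨v, hv0, hv⟩ := finrank_eq_one_iff'.1 hℓ
  have hv0' : ‖(v : EuclideanSpace ℝ (Fin N))‖ ≠ 0 := by
    simpa using hv0
  obtain ⟨p, hp, hpx⟩ := hnear x hx (by simpa using hr.le)
  refine ⟨(‖(v : EuclideanSpace ℝ (Fin N))‖)⁻¹ • (v : EuclideanSpace ℝ (Fin N)), ?_, ?_⟩
  · rw [norm_smul, norm_inv, norm_norm, inv_mul_cancel₀ hv0']
  · intro y hy hyr
    obtain ⟨q, hq, hqy⟩ := hnear y hy hyr
    obtain ⟨t, ht⟩ := hv ⟨q - p, AffineSubspace.vsub_mem_direction hq hp⟩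
    have ht' : t • (v : EuclideanSpace ℝ (Fin N)) = q - p := congrArg Subtype.val ht
    refine ⟨t * ‖(v : EuclideanSpace ℝ (Fin N))‖, ?_⟩
    rw [smul_smul, mul_assoc, mul_inv_cancel₀ hv0', mul_one, ht']
    have : y - x - (q - p) = (y - q) - (x - p) := by abel
    rw [this]
    rw [dist_eq_norm] at hpx hqy
    refine (norm_sub_le _ _).trans ?_
    linarith

/-! ### Comparison of flat directions up to sign. -/

section directions

variable {V : Type*} [NormedAddCommGroup V] [InnerProductSpace ℝ V]

theorem norm_smul_sub_le_or_norm_smul_add_le {v d : V} (hv : ‖v‖ = 1) {t ε : ℝ}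
    (h : ‖d - t • v‖ ≤ ε) : ‖‖d‖ • v - d‖ ≤ 2 * ε ∨ ‖‖d‖ • v + d‖ ≤ 2 * ε := by
  have h1 : abs (‖d‖ - abs t) ≤ ε := by
    have := abs_norm_sub_norm_le d (t • v)
    rw [norm_smul, hv, mul_one, Real.norm_eq_abs] at this
    exact this.trans h
  rcases le_total 0 t with ht | ht
  · left
    rw [abs_of_nonneg ht] at h1
    have : ‖d‖ • v - d = (‖d‖ - t) • v - (d - t • v) := by rw [sub_smul]; abel
    rw [this]
    refine (norm_sub_le _ _).trans ?_
    rw [norm_smul, hv, mul_one, Real.norm_eq_abs]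
    linarith
  · right
    rw [abs_of_nonpos ht, sub_neg_eq_add] at h1
    have : ‖d‖ • v + d = (‖d‖ + t) • v + (d - t • v) := by rw [add_smul]; abel
    rw [this]
    refine (norm_add_le _ _).trans ?_
    rw [norm_smul, hv, mul_one, Real.norm_eq_abs]
    linarith

theorem norm_sub_le_or_norm_add_le_of_near {v w d : V} (hv : ‖v‖ = 1) (hw : ‖w‖ = 1) {s t ε : ℝ}
    (hd : 0 < ‖d‖) (h1 : ‖d - s • v‖ ≤ ε * ‖d‖) (h2 : ‖d - t • w‖ ≤ ε * ‖d‖) :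
    ‖v - w‖ ≤ 4 * ε ∨ ‖v + w‖ ≤ 4 * ε := by
  have key : ∀ z : V, ‖‖d‖ • z‖ ≤ 4 * (ε * ‖d‖) → ‖z‖ ≤ 4 * ε := by
    intro z hz
    rw [norm_smul, norm_norm] at hz
    nlinarith
  rcases norm_smul_sub_le_or_norm_smul_add_le hv h1 with a | a <;>
  rcases norm_smul_sub_le_or_norm_smul_add_le hw h2 with b | b
  · left
    apply key
    have : ‖d‖ • (v - w) = (‖d‖ • v - d) - (‖d‖ • w - d) := by rw [smul_sub]; abel
    rw [this]
    exact (norm_sub_le _ _).trans (by linarith)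
  · right
    apply key
    have : ‖d‖ • (v + w) = (‖d‖ • v - d) + (‖d‖ • w + d) := by rw [smul_add]; abel
    rw [this]
    exact (norm_add_le _ _).trans (by linarith)
  · right
    apply key
    have : ‖d‖ • (v + w) = (‖d‖ • v + d) + (‖d‖ • w - d) := by rw [smul_add]; abel
    rw [this]
    exact (norm_add_le _ _).trans (by linarith)
  · left
    apply key
    have : ‖d‖ • (v - w) = (‖d‖ • v + d) - (‖d‖ • w + d) := by rw [smul_sub]; abel
    rw [this]
    exact (norm_sub_le _ _).trans (by linarith)

theorem IsFlatDirection.exists_norm_sub_le {E : Set V} {η r : ℝ} {x v : V}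
    (h : IsFlatDirection E η x r v) {y z : V} (hy : y ∈ E) (hz : z ∈ E) (hyx : dist y x ≤ r)
    (hzx : dist z x ≤ r) : ∃ t : ℝ, ‖y - z - t • v‖ ≤ 2 * η * r := by
  obtain ⟨s, hs⟩ := h.2 y hy hyx
  obtain ⟨t, ht⟩ := h.2 z hz hzx
  refine ⟨s - t, ?_⟩
  have : y - z - (s - t) • v = (y - x - s • v) - (z - x - t • v) := by rw [sub_smul]; abel
  rw [this]
  exact (norm_sub_le _ _).trans (by linarith)

/-- Both directions are nearly parallel to the common chord `y - z`, which is long relative to both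
radii. -/
theorem IsFlatDirection.norm_sub_le_or_norm_add_le {E : Set V} {r r' : ℝ} {x x' v v' : V}
    (h : IsFlatDirection E (1 / 1000) x r v) (h' : IsFlatDirection E (1 / 1000) x' r' v')
    {y z : V} (hy : y ∈ E) (hz : z ∈ E) (hyx : dist y x ≤ r) (hzx : dist z x ≤ r)
    (hyx' : dist y x' ≤ r') (hzx' : dist z x' ≤ r') (hyz : 0 < dist y z)
    (hr : r ≤ 4 * dist y z) (hr' : r' ≤ 4 * dist y z) : ‖v - v'‖ ≤ 1 / 8 ∨ ‖v + v'‖ ≤ 1 / 8 := by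
  obtain ⟨s, hs⟩ := h.exists_norm_sub_le hy hz hyx hzx
  obtain ⟨t, ht⟩ := h'.exists_norm_sub_le hy hz hyx' hzx'
  rw [dist_eq_norm] at *
  have := norm_sub_le_or_norm_add_le_of_near h.1 h'.1 (ε := 1 / 32) hyz
    (hs.trans (by linarith)) (ht.trans (by linarith))
  norm_num at this ⊢
  exact this

theorem IsFlatDirection.neg {E : Set V} {η r : ℝ} {x v : V} (h : IsFlatDirection E η x r v) :
    IsFlatDirection E η x r (-v) := by
  refine ⟨by rw [norm_neg, h.1], fun y hy hyx => ?_⟩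
  obtain ⟨t, ht⟩ := h.2 y hy hyx
  exact ⟨-t, by simpa using ht⟩

theorem IsFlatDirection.le_abs_inner {E : Set V} {r : ℝ} {x v : V}
    (h : IsFlatDirection E (1 / 1000) x r v) {y : V} (hy : y ∈ E) (hyx : dist y x ≤ r)
    (hr : r ≤ 16 * dist y x) : 3 / 4 * dist y x ≤ |inner ℝ v (y - x)| := by
  obtain ⟨t, ht⟩ := h.2 y hy hyx
  rw [dist_eq_norm] at *
  have h1 := abs_norm_sub_norm_le (y - x) (t • v)
  rw [norm_smul, h.1, mul_one, Real.norm_eq_abs] at h1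
  have h2 : |inner ℝ v (y - x - t • v)| ≤ ‖y - x - t • v‖ := by
    have := abs_real_inner_le_norm v (y - x - t • v)
    rwa [h.1, one_mul] at this
  rw [inner_sub_right, real_inner_smul_right, real_inner_self_eq_norm_sq, h.1] at h2
  have h3 := abs_sub_abs_le_abs_sub t (inner ℝ v (y - x))
  rw [abs_sub_comm] at h3
  have h4 := (abs_le.1 h1).2
  norm_num at h2
  linarith

/-- If two directions are close and both are nearly parallel to `d`, they orient `d` alike. -/
theorem inner_pos_iff_of_norm_sub_le {u u' d : V} (h : ‖u - u'‖ ≤ 1 / 8)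
    (hu : 3 / 4 * ‖d‖ ≤ |inner ℝ u d|) (hu' : 3 / 4 * ‖d‖ ≤ |inner ℝ u' d|) (hd : 0 < ‖d‖) :
    0 < inner ℝ u d ↔ 0 < inner ℝ u' d := by
  have h1 : |inner ℝ u d - inner ℝ u' d| ≤ 1 / 8 * ‖d‖ := by
    rw [← inner_sub_left]
    exact (abs_real_inner_le_norm _ _).trans (by gcongr)
  have h2 := abs_le.1 h1
  constructor
  · intro h
    rw [abs_of_pos h] at hu
    linarith
  · intro h
    rw [abs_of_pos h] at hu'
    linarith

end directions

/-! ### Coherent orientation and the tournament it defines. -/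

section orientation

variable {V : Type*} [NormedAddCommGroup V] [InnerProductSpace ℝ V]

/-- A crude bound excludes the opposite sign, and the sharp bound follows. This keeps errors from
accumulating over infinitely many scales. -/
theorem norm_sub_le_of_or {u w : V} (hu : ‖u‖ = 1) (h : ‖u - w‖ ≤ 1 / 2)
    (hor : ‖u - w‖ ≤ 1 / 8 ∨ ‖u + w‖ ≤ 1 / 8) : ‖u - w‖ ≤ 1 / 8 := by
  rcases hor with h1 | h1
  · exact h1
  · have h2 : ‖(2 : ℝ) • u‖ ≤ 1 / 2 + 1 / 8 := by
      have : (2 : ℝ) • u = (u - w) + (u + w) := by rw [two_smul]; abel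
      rw [this]
      exact (norm_add_le _ _).trans (add_le_add h h1)
    rw [norm_smul, hu] at h2
    norm_num at h2

open Classical in
/-- The one of `v`, `-v` that is close to `p`, if there is one. -/
noncomputable def orientTowards {W : Type*} [NormedAddCommGroup W] (p v : W) : W := if ‖p - v‖ ≤ 1 / 8 then v else -v

theorem norm_sub_orientTowards_le {W : Type*} [NormedAddCommGroup W] {p v : W} (h : ‖p - v‖ ≤ 1 / 8 ∨ ‖p + v‖ ≤ 1 / 8) :
    ‖p - orientTowards p v‖ ≤ 1 / 8 := by
  unfold orientTowards
  split_ifs with h1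
  · exact h1
  · rw [sub_neg_eq_add]
    exact h.resolve_left h1

theorem IsFlatDirection.orientTowards {E : Set V} {η r : ℝ} {x v : V}
    (h : IsFlatDirection E η x r v) (p : V) : IsFlatDirection E η x r (orientTowards p v) := by
  unfold _root_.orientTowards
  split_ifs
  · exact h
  · exact h.neg

/-- Oriented flat directions at the scales `D / 2 ^ k`, starting from the directions `w`. -/
noncomputable def orientedDirection (p : V) (w : ℕ → V → V) : ℕ → V → V
  | 0, x => orientTowards p (w 0 x)
  | k + 1, x => orientTowards (orientedDirection p w k x) (w (k + 1) x)

/-- Each point inherits its sign from the next coarser scale. For neighbours, three errors of `1 /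
8` stay below `1 / 2`, so `norm_sub_le_of_or` restores `1 / 8` at every step. -/
theorem exists_oriented_directions {E : Set V} {D : ℝ} (hD : 0 < D) (hne : E.Nonempty)
    (hdist : ∀ x ∈ E, ∀ y ∈ E, dist x y ≤ D)
    (hsphere : ∀ x ∈ E, ∀ ρ, 0 ≤ ρ → ρ ≤ D / 2 → ∃ z ∈ E, dist z x = ρ)
    (hflat : ∀ x ∈ E, ∀ r, 0 < r → r ≤ D → ∃ v, IsFlatDirection E (1 / 1000) x r v) :
    ∃ u : ℕ → V → V, ∀ k, ∀ x ∈ E, IsFlatDirection E (1 / 1000) x (D / 2 ^ k) (u k x) ∧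
      ‖u k x - u (k + 1) x‖ ≤ 1 / 8 ∧
      ∀ y ∈ E, dist x y ≤ D / 2 ^ k → ‖u k x - u k y‖ ≤ 1 / 8 := by
  have hr0 : ∀ k : ℕ, 0 < D / 2 ^ k := fun k => by positivity
  have hrD : ∀ k : ℕ, D / 2 ^ k ≤ D := fun k =>
    div_le_self hD.le (one_le_pow₀ (by norm_num))
  have hex : ∀ (k : ℕ) (x : V), ∃ v, x ∈ E → IsFlatDirection E (1 / 1000) x (D / 2 ^ k) v := by
    intro k x
    by_cases hx : x ∈ E
    · obtain ⟨v, hv⟩ := hflat x hx _ (hr0 k) (hrD k)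
      exact ⟨v, fun _ => hv⟩
    · exact ⟨0, fun h => absurd h hx⟩
  choose w hw using hex
  obtain ⟨a, ha⟩ := hne
  set u := orientedDirection (w 0 a) w with hu
  have huflat : ∀ k, ∀ x ∈ E, IsFlatDirection E (1 / 1000) x (D / 2 ^ k) (u k x) := by
    intro k x hx
    cases k with
    | zero => exact (hw 0 x hx).orientTowards _
    | succ k => exact (hw (k + 1) x hx).orientTowards _
  have same : ∀ x ∈ E, ∀ y ∈ E, ∀ r, 0 < r → r ≤ D → dist x y ≤ r → ∀ v v',
      IsFlatDirection E (1 / 1000) x r v → IsFlatDirection E (1 / 1000) y r v' →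
      ‖v - v'‖ ≤ 1 / 8 ∨ ‖v + v'‖ ≤ 1 / 8 := by
    intro x hx y hy r hr hrD hxy v v' hv hv'
    by_cases hc : r ≤ 4 * dist x y
    · exact hv.norm_sub_le_or_norm_add_le hv' hx hy (by simpa using hr.le)
        (by rwa [dist_comm]) hxy (by simpa using hr.le) (by linarith) hc hc
    -- When `x` and `y` are too close to serve as a chord, an auxiliary point at distance `r / 4`
    -- replaces `x`.
    · obtain ⟨z, hz, hzy⟩ := hsphere y hy (r / 4) (by linarith) (by linarith)
      have h1 := dist_triangle z y x
      rw [dist_comm y x] at h1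
      exact hv.norm_sub_le_or_norm_add_le hv' hz hy (by linarith)
        (by rwa [dist_comm]) (by linarith) (by simpa using hr.le) (by linarith) (by linarith)
        (by linarith)
  have hstep : ∀ k, ∀ x ∈ E, ‖u k x - u (k + 1) x‖ ≤ 1 / 8 := by
    intro k x hx
    apply norm_sub_orientTowards_le
    have hk : D / 2 ^ (k + 1) = D / 2 ^ k / 2 := by rw [pow_succ, div_div]
    obtain ⟨z, hz, hzx⟩ := hsphere x hx (D / 2 ^ (k + 1)) (hr0 _).le
      (by rw [hk]; linarith [hrD k])
    have h0 := hr0 k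
    exact (huflat k x hx).norm_sub_le_or_norm_add_le (hw (k + 1) x hx) hz hx (by linarith)
      (by simpa using h0.le) hzx.le (by simpa using (hr0 _).le) (by linarith) (by linarith)
      (by linarith)
  refine ⟨u, fun k x hx => ⟨huflat k x hx, hstep k x hx, ?_⟩⟩
  induction k generalizing x with
  | zero =>
    intro y hy hxy
    have hc : ∀ z ∈ E, ‖w 0 a - u 0 z‖ ≤ 1 / 8 := fun z hz =>
      norm_sub_orientTowards_le (same a ha z hz _ (hr0 0) (hrD 0)
        (by simpa using hdist a ha z hz) _ _ (hw 0 a ha) (hw 0 z hz))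
    refine norm_sub_le_of_or (huflat 0 x hx).1 ?_
      (same x hx y hy _ (hr0 0) (hrD 0) hxy _ _ (huflat 0 x hx) (huflat 0 y hy))
    have : u 0 x - u 0 y = (w 0 a - u 0 y) - (w 0 a - u 0 x) := by abel
    rw [this]
    exact (norm_sub_le _ _).trans (by linarith [hc x hx, hc y hy])
  | succ k ih =>
    intro y hy hxy
    refine norm_sub_le_of_or (huflat _ x hx).1 ?_
      (same x hx y hy _ (hr0 _) (hrD _) hxy _ _ (huflat _ x hx) (huflat _ y hy))
    have hk : D / 2 ^ (k + 1) = D / 2 ^ k / 2 := by rw [pow_succ, div_div]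
    have h1 := ih x hx y hy (by linarith [hr0 k])
    have : u (k + 1) x - u (k + 1) y =
        (u k x - u k y) - (u k x - u (k + 1) x) + (u k y - u (k + 1) y) := by abel
    rw [this]
    have h2 := norm_add_le ((u k x - u k y) - (u k x - u (k + 1) x)) (u k y - u (k + 1) y)
    have h3 := norm_sub_le (u k x - u k y) (u k x - u (k + 1) x)
    linarith [hstep k x hx, hstep k y hy]

theorem exists_scale {D d : ℝ} (hd : 0 < d) (hdD : d ≤ D) :
    ∃ k : ℕ, d ≤ D / 2 ^ k ∧ D / 2 ^ k ≤ 2 * d := by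
  obtain ⟨k, h1, h2⟩ := exists_nat_pow_near (x := D / d) (y := 2)
    ((one_le_div hd).2 hdD) (by norm_num)
  have hk : (0 : ℝ) < 2 ^ k := by positivity
  refine ⟨k, ?_, ?_⟩
  · rw [le_div_iff₀ hd] at h1
    rw [le_div_iff₀ hk]
    linarith
  · rw [div_lt_iff₀ hd, pow_succ] at h2
    rw [div_le_iff₀ hk]
    linarith

/-- A flat connected set carries a tournament that is locally constant off the diagonal. -/
theorem exists_locally_constant_tournament {E : Set V} {D : ℝ} (hD : 0 < D) (hne : E.Nonempty)
    (hdist : ∀ x ∈ E, ∀ y ∈ E, dist x y ≤ D)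
    (hsphere : ∀ x ∈ E, ∀ ρ, 0 ≤ ρ → ρ ≤ D / 2 → ∃ z ∈ E, dist z x = ρ)
    (hflat : ∀ x ∈ E, ∀ r, 0 < r → r ≤ D → ∃ v, IsFlatDirection E (1 / 1000) x r v) :
    ∃ R : V → V → Prop, (∀ x, ¬ R x x) ∧
      (∀ x ∈ E, ∀ y ∈ E, x ≠ y → (R x y ↔ ¬ R y x)) ∧
      ∀ x ∈ E, ∀ y ∈ E, ∀ z ∈ E, x ≠ y → dist z y ≤ dist y x / 4 → (R x y ↔ R x z) := by
  obtain ⟨u, hu⟩ := exists_oriented_directions hD hne hdist hsphere hflat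
  have hrs : ∀ k : ℕ, D / 2 ^ (k + 1) = D / 2 ^ k / 2 := fun k => by rw [pow_succ, div_div]
  have hr0 : ∀ k : ℕ, 0 < D / 2 ^ k := fun k => by positivity
  have inner_ge : ∀ k, ∀ x ∈ E, ∀ y ∈ E, dist y x ≤ D / 2 ^ k → D / 2 ^ k ≤ 16 * dist y x →
      3 / 4 * ‖y - x‖ ≤ |inner ℝ (u k x) (y - x)| := by
    intro k x hx y hy h1 h2
    rw [← dist_eq_norm]
    exact (hu k x hx).1.le_abs_inner hy h1 h2
  have up : ∀ k j, k ≤ j → ∀ x ∈ E, ∀ y ∈ E, D / 2 ^ k ≤ 16 * dist y x → dist y x ≤ D / 2 ^ j →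
      (0 < inner ℝ (u k x) (y - x) ↔ 0 < inner ℝ (u j x) (y - x)) := by
    intro k j hkj x hx y hy hk
    have hpos : 0 < dist y x := by linarith [hr0 k]
    induction j, hkj using Nat.le_induction with
    | base => exact fun _ => Iff.rfl
    | succ j hkj ih =>
      intro hj
      have hjr := hr0 j
      have hle : D / 2 ^ j ≤ D / 2 ^ k :=
        div_le_div_of_nonneg_left hD.le (by positivity) (pow_le_pow_right₀ (by norm_num) hkj)
      have := hrs j
      have hj' : dist y x ≤ D / 2 ^ j := by linarith
      refine (ih hj').trans (inner_pos_iff_of_norm_sub_le (hu j x hx).2.1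
        (inner_ge j x hx y hy hj' (by linarith)) (inner_ge (j + 1) x hx y hy hj (by linarith)) ?_)
      rwa [← dist_eq_norm]
  -- Several scales may be admissible; `up` shows that they give the same sign. The slack factor 16
  -- lets two nearby points be tested at one common scale.
  let R : V → V → Prop := fun x y => ∃ k, dist y x ≤ D / 2 ^ k ∧ D / 2 ^ k ≤ 16 * dist y x ∧
    0 < inner ℝ (u k x) (y - x)
  have hR : ∀ k, ∀ x ∈ E, ∀ y ∈ E, dist y x ≤ D / 2 ^ k → D / 2 ^ k ≤ 16 * dist y x →
      (R x y ↔ 0 < inner ℝ (u k x) (y - x)) := by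
    intro k x hx y hy h1 h2
    constructor
    · rintro ⟨j, h3, h4, h5⟩
      rcases le_total k j with h | h
      · exact (up k j h x hx y hy h2 h3).2 h5
      · exact (up j k h x hx y hy h4 h1).1 h5
    · exact fun h => ⟨k, h1, h2, h⟩
  refine ⟨R, ?_, ?_, ?_⟩
  · rintro x ⟨k, -, -, h⟩
    simp at h
  · intro x hx y hy hxy
    have hpos : 0 < dist y x := dist_pos.2 hxy.symm
    obtain ⟨k, h1, h2⟩ := exists_scale hpos (hdist y hy x hx)
    have h1' : dist x y ≤ D / 2 ^ k := by rwa [dist_comm]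
    have h2' : D / 2 ^ k ≤ 16 * dist x y := by rw [dist_comm]; linarith
    rw [hR k x hx y hy h1 (by linarith), hR k y hy x hx h1' h2']
    have hI := inner_ge k y hy x hx h1' h2'
    rw [inner_pos_iff_of_norm_sub_le ((hu k x hx).2.2 y hy h1')
      (inner_ge k x hx y hy h1 (by linarith)) (by
        rw [← neg_sub x y, norm_neg, inner_neg_right, abs_neg]; exact hI)
      (by rwa [← dist_eq_norm]), ← neg_sub x y, inner_neg_right]
    rw [← dist_eq_norm, dist_comm] at hI
    constructor
    · intro h; linarith
    · intro h
      rw [abs_of_nonpos (not_lt.1 h)] at hI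
      linarith
  · intro x hx y hy z hz hxy hzy
    have hpos : 0 < dist y x := dist_pos.2 hxy.symm
    have t1 := dist_triangle z y x
    have t2 := dist_triangle_left y x z
    obtain ⟨k, h1, h2⟩ := exists_scale (D := D) (d := max (dist y x) (dist z x))
      (lt_max_of_lt_left hpos) (max_le (hdist y hy x hx) (hdist z hz x hx))
    have h3 : max (dist y x) (dist z x) ≤ 5 / 4 * dist y x := max_le (by linarith) (by linarith)
    have hy1 := (le_max_left _ _).trans h1
    have hz1 := (le_max_right _ _).trans h1
    rw [dist_comm] at t2
    have hz2 : D / 2 ^ k ≤ 16 * dist z x := by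
      have := dist_triangle_left y x z
      linarith
    rw [hR k x hx y hy hy1 (by linarith), hR k x hx z hz hz1 hz2]
    have hI := inner_ge k x hx y hy hy1 (by linarith)
    have hI' := inner_ge k x hx z hz hz1 hz2
    rw [← dist_eq_norm] at hI hI'
    -- Moving `y` to `z` changes the inner product by at most a quarter of `dist y x`, too little to
    -- reverse its sign.
    have hdiff : |inner ℝ (u k x) (y - x) - inner ℝ (u k x) (z - x)| ≤ dist z y := by
      rw [← inner_sub_right, sub_sub_sub_cancel_right, dist_comm, dist_eq_norm]
      have := abs_real_inner_le_norm (u k x) (y - z)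
      rwa [(hu k x hx).1.1, one_mul] at this
    have h4 := abs_le.1 hdiff
    constructor
    · intro h
      rw [abs_of_pos h] at hI
      linarith
    · intro h
      by_contra hn
      rw [abs_of_nonpos (not_lt.1 hn)] at hI
      rw [abs_of_pos h] at hI'
      linarith
end orientation

/-! ### Order structure from connectedness. -/

/-- A tournament on a metric space that is locally constant off the diagonal, quantitatively. -/
structure IsLocallyConstantTournament {X : Type*} [MetricSpace X] (R : X → X → Prop) : Prop where
  irrefl : ∀ x, ¬ R x x
  iff_not_swap : ∀ x y, x ≠ y → (R x y ↔ ¬ R y x)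
  iff_of_dist_le : ∀ x y z, x ≠ y → dist z y ≤ dist y x / 4 → (R x y ↔ R x z)

namespace IsLocallyConstantTournament

variable {X : Type*} [MetricSpace X] {R : X → X → Prop}

theorem ne (h : IsLocallyConstantTournament R) {x y : X} (hxy : R x y) : x ≠ y := by
  rintro rfl
  exact h.irrefl _ hxy

theorem asymm (h : IsLocallyConstantTournament R) {x y : X} (hxy : R x y) : ¬ R y x :=
  (h.iff_not_swap x y (h.ne hxy)).1 hxy

theorem trichotomous (h : IsLocallyConstantTournament R) (x y : X) : R x y ∨ x = y ∨ R y x := by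
  by_cases hxy : x = y
  · exact Or.inr (Or.inl hxy)
  · by_cases h' : R y x
    · exact Or.inr (Or.inr h')
    · exact Or.inl ((h.iff_not_swap x y hxy).2 h')

/-- Transfers local constancy from the second argument to the first. -/
theorem swap (h : IsLocallyConstantTournament R) :
    IsLocallyConstantTournament fun x y => R y x := by
  refine ⟨h.irrefl, fun x y hxy => h.iff_not_swap y x hxy.symm, fun x y z hxy hz => ?_⟩
  have hzx : z ≠ x := by
    rintro rfl
    have := dist_pos.2 hxy.symm
    rw [dist_comm z y] at hz
    linarith
  rw [h.iff_not_swap y x hxy.symm, h.iff_not_swap z x hzx, h.iff_of_dist_le x y z hxy hz]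

theorem isOpen_setOf (h : IsLocallyConstantTournament R) (x : X) : IsOpen {y | R x y} := by
  rw [Metric.isOpen_iff]
  intro y hy
  have hxy := h.ne hy
  refine ⟨dist y x / 4, by linarith [dist_pos.2 hxy.symm], fun z hz => ?_⟩
  exact (h.iff_of_dist_le x y z hxy (mem_ball.1 hz).le).1 hy

theorem isClosed_setOf (h : IsLocallyConstantTournament R) (x : X) :
    IsClosed {y | R x y ∨ y = x} := by
  have : {y | R x y ∨ y = x} = {y | R y x}ᶜ := by
    ext y
    change R x y ∨ y = x ↔ ¬ R y x
    constructor
    · rintro (h1 | rfl)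
      · exact h.asymm h1
      · exact h.irrefl _
    · intro h1
      rcases h.trichotomous x y with h2 | h2 | h2
      · exact Or.inl h2
      · exact Or.inr h2.symm
      · exact absurd h2 h1
  rw [this]
  exact (h.swap.isOpen_setOf x).isClosed_compl

/-- Given `R x y`, the points that would close a 3-cycle with `x` and `y` form a clopen set: no
boundary case can occur. It omits `x`, so it is empty. -/
theorem trans [PreconnectedSpace X] (h : IsLocallyConstantTournament R) {x y z : X}
    (hxy : R x y) (hyz : R y z) : R x z := by
  by_contra hxz
  have hclopen : IsClopen {v | R v x ∧ R y v} := by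
    refine ⟨?_, (h.swap.isOpen_setOf x).inter (h.isOpen_setOf y)⟩
    have : {v | R v x ∧ R y v} = {v | R v x ∨ v = x} ∩ {v | R y v ∨ v = y} := by
      ext v
      constructor
      · exact fun hv => ⟨Or.inl hv.1, Or.inl hv.2⟩
      · rintro ⟨h1 | rfl, h2 | rfl⟩
        · exact ⟨h1, h2⟩
        · exact absurd h1 (h.asymm hxy)
        · exact absurd h2 (h.asymm hxy)
        · exact absurd hxy (h.irrefl _)
    rw [this]
    exact (h.swap.isClosed_setOf x).inter (h.isClosed_setOf y)
  rcases isClopen_iff.1 hclopen with he | he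
  · have hz : z ∈ {v | R v x ∧ R y v} := by
      refine ⟨?_, hyz⟩
      rcases h.trichotomous x z with h1 | rfl | h1
      · exact absurd h1 hxz
      · exact absurd hxy (h.asymm hyz)
      · exact h1
    rw [he] at hz
    exact hz
  · have hx : x ∈ {v | R v x ∧ R y v} := he ▸ Set.mem_univ x
    exact h.irrefl _ hx.1

/-- Without such a point, the predecessors of `x` together with the predecessors of `y` within `ρ`
of `x` form a clopen set containing `x` but not `y`. -/
theorem exists_between [PreconnectedSpace X] (h : IsLocallyConstantTournament R) {x y : X}
    (hxy : R x y) {ρ : ℝ} (hρ : 0 < ρ) (hρ' : ρ < dist x y) :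
    ∃ z, R x z ∧ R z y ∧ dist z x = ρ := by
  by_contra! hno
  set A : Set X := {w | R w x} ∪ {w | R w y ∧ dist w x < ρ} with hA
  have hAopen : IsOpen A := (h.swap.isOpen_setOf x).union
    ((h.swap.isOpen_setOf y).inter (isOpen_lt (continuous_id.dist continuous_const) continuous_const))
  have hAeq : A = {w | R w x ∨ w = x} ∪ ({w | R w y ∨ w = y} ∩ {w | dist w x ≤ ρ}) := by
    ext w
    constructor
    · rintro (h1 | ⟨h1, h2⟩)
      · exact Or.inl (Or.inl h1)
      · exact Or.inr ⟨Or.inl h1, h2.le⟩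
    · rintro ((h1 | rfl) | ⟨h1 | rfl, h2⟩)
      · exact Or.inl h1
      · exact Or.inr ⟨hxy, by simpa using hρ⟩
      · rcases h.trichotomous x w with h3 | rfl | h3
        · exact Or.inr ⟨h1, lt_of_le_of_ne h2 (hno w h3 h1)⟩
        · exact Or.inr ⟨hxy, by simpa using hρ⟩
        · exact Or.inl h3
      · exact absurd (show dist w x ≤ ρ from h2) (by rw [dist_comm]; exact not_le.2 hρ')
  have hclopen : IsClopen A := by
    refine ⟨?_, hAopen⟩
    rw [hAeq]
    exact (h.swap.isClosed_setOf x).union ((h.swap.isClosed_setOf y).inter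
      (isClosed_le (continuous_id.dist continuous_const) continuous_const))
  rcases isClopen_iff.1 hclopen with he | he
  · have hx : x ∈ A := Or.inr ⟨hxy, by simpa using hρ⟩
    rw [he] at hx
    exact hx
  · have hy : y ∈ A := he ▸ Set.mem_univ y
    rcases hy with h1 | h1
    · exact h.asymm hxy h1
    · exact h.irrefl _ h1.1

/-- The open interval between two points contains a ball of comparable size. -/
theorem exists_ball_subset [PreconnectedSpace X] (h : IsLocallyConstantTournament R) {x y : X}
    (hxy : R x y) : ∃ z, ball z (dist x y / 8) ⊆ {w | R x w ∧ R w y} := by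
  have hpos := dist_pos.2 (h.ne hxy)
  obtain ⟨z, hxz, hzy, hz⟩ := h.exists_between hxy (half_pos hpos) (half_lt_self hpos)
  refine ⟨z, fun w hw => ?_⟩
  have hw' := (mem_ball.1 hw).le
  have := dist_triangle_left x y z
  refine ⟨(h.iff_of_dist_le x z w (h.ne hxz) (by linarith)).1 hxz,
    (h.swap.iff_of_dist_le y z w (h.ne hzy).symm (by linarith)).1 hzy⟩

/-- Seen from a point `w` far away, `x` and `y` lie on the same side. -/
theorem dist_le_of_between (h : IsLocallyConstantTournament R) {x y w : X} (hxw : R x w)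
    (hwy : R w y) : dist w y ≤ 4 * dist x y := by
  by_contra! hlt
  exact h.asymm hxw ((h.iff_of_dist_le w y x (h.ne hwy) (by rw [dist_comm y w]; linarith)).1 hwy)

/-! ### Measure of initial segments. -/

variable [MeasurableSpace X]

theorem measure_add_le [BorelSpace X] [PreconnectedSpace X] (h : IsLocallyConstantTournament R) (μ : Measure X)
    {x y : X} (hxy : R x y) {m : ℝ≥0∞} (hm : ∀ z, m ≤ μ (ball z (dist x y / 8))) :
    μ {w | R w x} + m ≤ μ {w | R w y} := by
  obtain ⟨z, hz⟩ := h.exists_ball_subset hxy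
  calc μ {w | R w x} + m ≤ μ {w | R w x} + μ (ball z (dist x y / 8)) := by gcongr; exact hm z
    _ = μ ({w | R w x} ∪ ball z (dist x y / 8)) := by
      refine (measure_union ?_ measurableSet_ball).symm
      rw [Set.disjoint_left]
      exact fun w hw hw' => h.asymm hw (hz hw').1
    _ ≤ μ {w | R w y} := by
      refine measure_mono (Set.union_subset (fun w hw => h.trans hw hxy) fun w hw => (hz hw).2)

/-- A point preceding exactly one of `x`, `y` separates them, so it is close to `y` by local
constancy. -/
theorem abs_measureReal_sub_le (h : IsLocallyConstantTournament R) (μ : Measure X)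
    [IsFiniteMeasure μ] (x y : X) :
    |μ.real {w | R w x} - μ.real {w | R w y}| ≤ μ.real (closedBall y (4 * dist x y)) := by
  have hsub : ∀ a b : X, {w | R w a} ⊆ {w | R w b} ∪ {w | R w a ∧ ¬ R w b} := fun a b w hw => by
    by_cases hb : R w b
    · exact Or.inl hb
    · exact Or.inr ⟨hw, hb⟩
  have hle : ∀ a b : X, {w | R w a ∧ ¬ R w b} ⊆ closedBall y (4 * dist x y) →
      μ.real {w | R w a} ≤ μ.real {w | R w b} + μ.real (closedBall y (4 * dist x y)) :=
    fun a b hab => (measureReal_mono (hsub a b)).trans <| (measureReal_union_le _ _).trans <| by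
      gcongr
      exact measure_ne_top _ _
  rw [abs_sub_le_iff]
  have h1 := hle x y fun w hw => by
    rw [mem_closedBall]
    rcases h.trichotomous w y with h1 | rfl | h1
    · exact absurd h1 hw.2
    · rw [dist_self]; positivity
    · rw [dist_comm]
      by_contra! hlt
      exact h.asymm hw.1 ((h.swap.iff_of_dist_le w y x (h.ne h1).symm (by linarith)).1 h1)
  have h2 := hle y x fun w hw => by
    rw [mem_closedBall]
    rcases h.trichotomous w x with h1 | rfl | h1
    · exact absurd h1 hw.2
    · linarith [dist_nonneg (x := w) (y := y)]
    · exact h.dist_le_of_between h1 hw.1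
  constructor <;> linarith

/-- No upper regularity is needed: the measure of shrinking balls around `y` tends to that of `{y}`,
which is zero. -/
theorem continuous_measureReal [BorelSpace X] (h : IsLocallyConstantTournament R) (μ : Measure X)
    [IsFiniteMeasure μ] [NullSingletonClass μ] : Continuous fun x => μ.real {w | R w x} := by
  rw [continuous_iff_continuousAt]
  intro y
  have h0 : Filter.Tendsto (fun ρ => μ (cthickening ρ {y})) (nhds 0) (nhds 0) := by
    have := tendsto_measure_cthickening_of_isClosed (μ := μ) (s := {y})
      ⟨1, one_pos, measure_ne_top _ _⟩ isClosed_singleton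
    rwa [measure_singleton] at this
  have h1 : Filter.Tendsto (fun x => 4 * dist x y) (nhds y) (nhds 0) := by
    have : Continuous fun x => 4 * dist x y := by fun_prop
    simpa using this.tendsto y
  have h2 : Filter.Tendsto (fun x => μ.real (closedBall y (4 * dist x y))) (nhds y) (nhds 0) := by
    have := (ENNReal.tendsto_toReal ENNReal.zero_ne_top).comp (h0.comp h1)
    refine this.congr fun x => ?_
    simp only [Function.comp, Measure.real]
    rw [cthickening_singleton _ (by positivity)]
  rw [ContinuousAt, tendsto_iff_dist_tendsto_zero]
  exact squeeze_zero (fun _ => dist_nonneg)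
    (fun x => by rw [Real.dist_eq]; exact h.abs_measureReal_sub_le μ x y) h2

end IsLocallyConstantTournament

/-! ### The Hölder parametrization and the main theorem. -/

theorem IsLocallyConstantTournament.exists_holderWith_bijective {X : Type*} [MetricSpace X]
    [CompactSpace X] [PreconnectedSpace X] [Nontrivial X] [MeasurableSpace X] [BorelSpace X]
    {R : X → X → Prop} (h : IsLocallyConstantTournament R) (μ : Measure X) [IsFiniteMeasure μ]
    [NullSingletonClass μ] {s c D : ℝ} (hs : 0 < s) (hc : 0 < c) (hdist : ∀ x y : X, dist x y ≤ D)
    (hμ : ∀ (x : X) (r : ℝ), 0 < r → r ≤ D → ENNReal.ofReal (c * r ^ s) ≤ μ (ball x r)) :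
    ∃ f : unitInterval → X, Function.Bijective f ∧
      HolderWith (Real.toNNReal (8 * (c⁻¹ * μ.real Set.univ) ^ (1 / s)))
        (Real.toNNReal (1 / s)) f := by
  set g : X → ℝ := fun x => μ.real {w | R w x} with hg
  have hgc : Continuous g := h.continuous_measureReal μ
  have hmono : ∀ x y, R x y → g x + c * (dist x y / 8) ^ s ≤ g y := by
    intro x y hxy
    have hpos := dist_pos.2 (h.ne hxy)
    have h1 := h.measure_add_le μ hxy
      (fun z => hμ z (dist x y / 8) (by positivity) (by linarith [hdist x y]))
    have h2 := ENNReal.toReal_mono (measure_ne_top _ _) h1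
    rwa [ENNReal.toReal_add (measure_ne_top _ _) ENNReal.ofReal_ne_top,
      ENNReal.toReal_ofReal (by positivity)] at h2
  have hsep : ∀ x y, c * (dist x y / 8) ^ s ≤ |g x - g y| := by
    intro x y
    rcases h.trichotomous x y with hxy | rfl | hxy
    · have := hmono x y hxy
      rw [abs_sub_comm]
      exact le_trans (by linarith) (le_abs_self _)
    · simp [Real.zero_rpow hs.ne']
    · have := hmono y x hxy
      rw [dist_comm] at this
      exact le_trans (by linarith) (le_abs_self _)
  have hinj : Function.Injective g := by
    intro x y hxy
    by_contra hne
    have h1 := hsep x y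
    have h2 : 0 < dist x y := dist_pos.2 hne
    have h3 : 0 < c * (dist x y / 8) ^ s := by positivity
    rw [hxy, sub_self, abs_zero] at h1
    linarith
  obtain ⟨p, -, hp⟩ := isCompact_univ.exists_isMinOn Set.univ_nonempty hgc.continuousOn
  obtain ⟨q, -, hq⟩ := isCompact_univ.exists_isMaxOn Set.univ_nonempty hgc.continuousOn
  have hp' : ∀ x, g p ≤ g x := fun x => hp (Set.mem_univ x)
  have hq' : ∀ x, g x ≤ g q := fun x => hq (Set.mem_univ x)
  have hW : 0 < g q - g p := by
    rw [sub_pos]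
    refine lt_of_le_of_ne (hp' q) fun heq => ?_
    obtain ⟨x, y, hxy⟩ := exists_pair_ne X
    exact hxy (hinj (by linarith [hp' x, hp' y, hq' x, hq' y]))
  have hWle : g q - g p ≤ μ.real Set.univ := by
    have h1 : 0 ≤ g p := measureReal_nonneg
    have h2 : g q ≤ μ.real Set.univ := measureReal_mono (Set.subset_univ _)
    linarith
  -- The map `f` inverts `g` after its range is rescaled affinely to the unit interval.
  have hex : ∀ t : unitInterval, ∃ x, g x = g p + t * (g q - g p) := by
    intro t
    refine intermediate_value_univ p q hgc ⟨?_, ?_⟩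
    · nlinarith [t.2.1]
    · nlinarith [t.2.2]
  choose f hf using hex
  refine ⟨f, ⟨?_, ?_⟩, ?_⟩
  · intro t t' htt
    have h1 := hf t
    rw [htt, hf t', add_right_inj] at h1
    exact Subtype.ext (mul_right_cancel₀ hW.ne' h1).symm
  · intro x
    refine ⟨⟨(g x - g p) / (g q - g p), ?_, ?_⟩, hinj ?_⟩
    · exact div_nonneg (by linarith [hp' x]) hW.le
    · exact (div_le_one hW).2 (by linarith [hq' x])
    · rw [hf]
      simp only
      rw [div_mul_cancel₀ _ hW.ne']
      ring
  · intro t t'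
    have hle : c * (dist (f t) (f t') / 8) ^ s ≤ μ.real Set.univ * dist t t' := by
      refine (hsep _ _).trans ?_
      have : g (f t) - g (f t') = (g q - g p) * ((t : ℝ) - t') := by
        rw [hf, hf]; ring
      rw [this, abs_mul, abs_of_pos hW, Subtype.dist_eq, Real.dist_eq]
      gcongr
    have hle2 : dist (f t) (f t') / 8 ≤ (c⁻¹ * μ.real Set.univ * dist t t') ^ (1 / s) := by
      rw [one_div, Real.le_rpow_inv_iff_of_pos (by positivity) (by positivity) hs, mul_assoc,
        ← div_eq_inv_mul, le_div_iff₀' hc]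
      exact hle
    rw [Real.mul_rpow (by positivity) dist_nonneg] at hle2
    rw [edist_dist, edist_dist t, Real.coe_toNNReal _ (by positivity),
      ENNReal.ofReal_rpow_of_nonneg dist_nonneg (by positivity)]
    change _ ≤ ENNReal.ofReal (8 * (c⁻¹ * μ.real Set.univ) ^ (1 / s)) * _
    rw [← ENNReal.ofReal_mul (by positivity)]
    exact ENNReal.ofReal_le_ofReal (by linarith)

theorem proposition1p3 :
    ∃ β₁ : ℝ, 0 < β₁ ∧ β₁ < 1 ∧
      ∀ s : ℝ, 1 < s →
        ∃ C : ℝ, 0 < C ∧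
          ∀ (N : ℕ) (E : Set (EuclideanSpace ℝ (Fin N))) (c : ℝ),
            IsCompact E → IsConnected E → E.Nontrivial →
            Measure.hausdorffMeasure s E < ∞ →
            IsLowerAhlforsRegular s c E →
            (∀ x ∈ E, ∀ r : ℝ, 0 < r → r ≤ diam E →
              jonesBeta E (closedBall x r) ≤ ENNReal.ofReal β₁) →
            ∃ (f : unitInterval → EuclideanSpace ℝ (Fin N)) (H : ℝ≥0),
              Function.Injective f ∧ Set.range f = E ∧
              HolderWith H (Real.toNNReal (1 / s)) f ∧
              (H : ℝ) ≤ C * (c⁻¹ * (Measure.hausdorffMeasure s E).toReal * diam E ^ (1 - s)) := by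
  -- Ten times `1 / 10000` is the flatness `1 / 1000`; the 8 comes from the balls of radius `dist x
  -- y / 8` inside order intervals.
  refine ⟨1 / 10000, by norm_num, by norm_num, fun s hs => ⟨8, by norm_num, ?_⟩⟩
  intro N E c hcpt hconn hnt hfin hreg hbeta
  have hs0 : 0 < s := one_pos.trans hs
  have hbdd := hcpt.isBounded
  have hD : 0 < diam E := Metric.diam_pos hnt hbdd
  have hdist : ∀ x ∈ E, ∀ y ∈ E, dist x y ≤ diam E := fun x hx y hy =>
    dist_le_diam_of_mem hbdd hx hy
  have hsphere : ∀ x ∈ E, ∀ ρ, 0 ≤ ρ → ρ ≤ diam E / 2 → ∃ z ∈ E, dist z x = ρ := by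
    intro x hx ρ hρ hρD
    -- The point farthest from `x` is at distance at least half the diameter; connectedness then
    -- yields every smaller distance.
    have hfar : ∃ y ∈ E, ρ ≤ dist y x := by
      by_contra! hno
      obtain ⟨y, hy, hmax⟩ := hcpt.exists_isMaxOn hconn.nonempty
        (f := fun y => dist y x) (by fun_prop)
      have h1 : diam E ≤ 2 * dist y x := by
        refine diam_le_of_forall_dist_le (by positivity) fun a ha b hb => ?_
        have h2 : dist a x ≤ dist y x := hmax ha
        have h3 : dist b x ≤ dist y x := hmax hb
        linarith [dist_triangle_right a b x]
      linarith [hno y hy]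
    obtain ⟨y, hy, hyx⟩ := hfar
    obtain ⟨z, hz, hzx⟩ := hconn.isPreconnected.intermediate_value hx hy
      (f := fun y => dist y x) (by fun_prop) ⟨by simpa using hρ, hyx⟩
    exact ⟨z, hz, hzx⟩
  have hflat : ∀ x ∈ E, ∀ r, 0 < r → r ≤ diam E → ∃ v, IsFlatDirection E (1 / 1000) x r v := by
    intro x hx r hr hrD
    have := exists_isFlatDirection_of_jonesBeta_le (by norm_num) hx hr (hbeta x hx r hr hrD)
    norm_num at this ⊢
    exact this
  obtain ⟨R, hR1, hR2, hR3⟩ :=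
    exists_locally_constant_tournament hD hconn.nonempty hdist hsphere hflat
  have hR : IsLocallyConstantTournament fun x y : E => R x y :=
    ⟨fun x => hR1 x, fun x y hxy => hR2 x x.2 y y.2 (Subtype.coe_injective.ne hxy),
      fun x y z hxy hz => hR3 x x.2 y y.2 z z.2 (Subtype.coe_injective.ne hxy) hz⟩
  have : CompactSpace E := isCompact_iff_compactSpace.1 hcpt
  have : PreconnectedSpace E := Subtype.preconnectedSpace hconn.isPreconnected
  have : Nontrivial E := hnt.coe_sort
  have himage : ∀ S : Set E, Measure.hausdorffMeasure s (Subtype.val '' S) =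
      Measure.hausdorffMeasure s S := fun S =>
    isometry_subtype_coe.hausdorffMeasure_image (Or.inl hs0.le) S
  have huniv : Measure.hausdorffMeasure s (Set.univ : Set E) = Measure.hausdorffMeasure s E := by
    rw [← himage, Set.image_univ, Subtype.range_coe]
  have : IsFiniteMeasure (Measure.hausdorffMeasure s : Measure E) := ⟨by rwa [huniv]⟩
  have : NullSingletonClass (Measure.hausdorffMeasure s : Measure E) :=
    Measure.nullSingletonClass_hausdorff E hs0
  have hball : ∀ (x : E) (r : ℝ), 0 < r → r ≤ diam E →
      ENNReal.ofReal (c * r ^ s) ≤ Measure.hausdorffMeasure s (ball x r) := by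
    intro x r hr hrD
    rw [← himage]
    convert hreg.2 x x.2 r hr hrD using 2
    ext y
    constructor
    · rintro ⟨z, hz, rfl⟩
      exact ⟨z.2, hz⟩
    · exact fun hy => ⟨⟨y, hy.1⟩, hy.2, rfl⟩
  obtain ⟨f, hf, hH⟩ := hR.exists_holderWith_bijective (Measure.hausdorffMeasure s) hs0 hreg.1
    (fun x y => hdist x x.2 y y.2) hball
  refine ⟨fun t => f t, _, Subtype.coe_injective.comp hf.1, ?_, hH, ?_⟩
  · rw [Set.range_comp' Subtype.val f, hf.2.range_eq, Set.image_univ, Subtype.range_coe]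
  · have hreal : (Measure.hausdorffMeasure s : Measure E).real Set.univ =
        (Measure.hausdorffMeasure s E).toReal := by rw [Measure.real, huniv]
    rw [hreal]
    set M := (Measure.hausdorffMeasure s E).toReal with hM
    have hc := hreg.1
    have hM0 : 0 ≤ M := ENNReal.toReal_nonneg
    obtain ⟨x, hx⟩ := hconn.nonempty
    have h1 : c * diam E ^ s ≤ M := by
      rw [← ENNReal.ofReal_le_iff_le_toReal hfin.ne]
      exact (hreg.2 x hx _ hD le_rfl).trans (measure_mono Set.inter_subset_left)
    set A := c⁻¹ * M / diam E ^ s with hA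
    have hDs : 0 < diam E ^ s := Real.rpow_pos_of_pos hD s
    -- Lower regularity at radius `diam E` gives `1 ≤ A`, so `A ^ (1 / s) ≤ A`; this turns the
    -- natural bound `8 * A ^ (1 / s) * diam E` into the required one.
    have hA1 : 1 ≤ A := by
      rw [hA, one_le_div hDs, ← div_eq_inv_mul, le_div_iff₀ hc]
      linarith
    have h2 : c⁻¹ * M = A * diam E ^ s := by rw [hA, div_mul_cancel₀ _ hDs.ne']
    rw [Real.coe_toNNReal _ (by positivity), h2, Real.rpow_sub hD, Real.rpow_one,
      Real.mul_rpow (by linarith) hDs.le, ← Real.rpow_mul hD.le, mul_one_div_cancel hs0.ne',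
      Real.rpow_one, mul_assoc A, mul_div_cancel₀ _ hDs.ne']
    have h3 : A ^ (1 / s) ≤ A := by
      conv_rhs => rw [← Real.rpow_one A]
      exact Real.rpow_le_rpow_of_exponent_le hA1 ((div_le_one hs0).2 hs.le)
    gcongr
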